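/- Let $\mathbb{T}=\{z\in\mathbb{C} : |z|=1\}$, let $r\ge 3$ be an integer, let $\varepsilon>0$ be a real number and let $L\ge 1$ be an integer. There exist $2^{r-1}$ integers $\Delta_A\ge 1$, one for each subset $A\subseteq\{1,\dots,r-1\}$, and two integers $\Theta\ge 1$ and $Q\ge 1$ (all depending only on $r$, $\varepsilon$ and $L$) such that the following holds. For every integer $H\ge 1$ and every $(\lambda_1,\dots,\lambda_r)\in\mathbb{T}^r$ there exists an integer $n$ belonging to one of the sets $$\{H\Delta_A(Lj+1) : 1\le j\le\Theta\}\quad (A\subseteq\{1,\dots,r-1\},\ A\neq\varnothing),\qquad \{H\Delta_\varnothing\},\qquad \{Hq+1 : 1\le q\le Q\}$$ (with $j$ and $q$ ranging over integers) such that $$\max_{1\le i\le r}|\lambda_i^n-1|<\varepsilon .$$ -/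

import Mathlib

open Filter Topology

/-! Expand `(1 + ∑ x i) ^ n` into characters. If every point of `γ * ω ^ j`, `1 ≤ j ≤ N`, has a
coordinate `ε`-far from `1`, the power is exponentially small there relative to its coefficient sum.
By Cauchy–Schwarz its diagonal mean square loses only a factor polynomial in `n`, so some
off-diagonal correlation must be substantial: some character from a fixed finite set is near `1` at
`ω` without staying near `1` along the progression (`exists_testing_frequencies`).

With `γ = lam` and `ω = lam ^ H`, either some `H * q + 1` works or `x = lam ^ H` almost satisfies a
nontrivial relation. Thereafter test `x ^ (Δ * (L * j + 1))`: relations dependent on those already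
found are harmless once `Δ` kills torsion, so each failure adds an independent relation. At full
rank `x ^ Δ` itself is near `1` (`exists_multipliers`). -/

/-- The character of the torus `ι → Circle` with frequency vector `k`. -/
noncomputable def torusChar {ι : Type*} [Fintype ι] (k : ι → ℤ) : (ι → Circle) →* Circle where
  toFun x := ∏ i, x i ^ k i
  map_one' := by simp
  map_mul' x y := by simp [mul_zpow, Finset.prod_mul_distrib]

lemma Circle.dist_one_right (z : Circle) : dist z 1 = ‖(z : ℂ) - 1‖ :=
  dist_eq_norm (z : ℂ) 1

/-! ### Characters and approximate relations -/

section Torus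

variable {ι : Type*} [Fintype ι]

lemma torusChar_apply (k : ι → ℤ) (x : ι → Circle) : torusChar k x = ∏ i, x i ^ k i := rfl

lemma torusChar_zero (x : ι → Circle) : torusChar 0 x = 1 := by simp [torusChar_apply]

lemma torusChar_add (k l : ι → ℤ) (x : ι → Circle) :
    torusChar (k + l) x = torusChar k x * torusChar l x := by
  simp [torusChar_apply, zpow_add, Finset.prod_mul_distrib]

lemma torusChar_sub (k l : ι → ℤ) (x : ι → Circle) :
    torusChar (k - l) x = torusChar k x * (torusChar l x)⁻¹ := by
  simp [torusChar_apply, zpow_sub, Finset.prod_mul_distrib]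

lemma torusChar_zsmul (n : ℤ) (k : ι → ℤ) (x : ι → Circle) :
    torusChar (n • k) x = torusChar k x ^ n := by
  simp [torusChar_apply, zpow_mul', Finset.prod_zpow]

lemma torusChar_single [DecidableEq ι] (i : ι) (x : ι → Circle) :
    torusChar (Pi.single i 1) x = x i := by
  rw [torusChar_apply, Finset.prod_eq_single i] <;> simp +contextual

/-- The filter of points of the torus at which all characters in `B` are close to `1`. -/
noncomputable def annihFilter (B : Set (ι → ℤ)) : Filter (ι → Circle) :=
  ⨅ b ∈ B, comap (torusChar b) (𝓝 1)

lemma annihFilter_insert (b : ι → ℤ) (B : Set (ι → ℤ)) :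
    annihFilter (insert b B) = comap (torusChar b) (𝓝 1) ⊓ annihFilter B :=
  iInf_insert

lemma tendsto_torusChar_annihFilter {B : Set (ι → ℤ)} {v : ι → ℤ}
    (hv : v ∈ Submodule.span ℤ B) : Tendsto (torusChar v) (annihFilter B) (𝓝 1) := by
  induction hv using Submodule.span_induction with
  | mem x hx => exact tendsto_iff_comap.2 (iInf₂_le x hx)
  | zero =>
    have : (torusChar 0 : (ι → Circle) → Circle) = fun _ => 1 := funext torusChar_zero
    rw [this]
    exact tendsto_const_nhds
  | add x y _ _ hx hy =>
    have : (torusChar (x + y) : (ι → Circle) → Circle) = fun z => torusChar x z * torusChar y z :=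
      funext (torusChar_add x y)
    rw [this]
    simpa using hx.mul hy
  | smul n x _ hx =>
    have : (torusChar (n • x) : (ι → Circle) → Circle) = fun z => torusChar x z ^ n :=
      funext (torusChar_zsmul n x)
    rw [this]
    simpa using hx.zpow n

lemma eventually_norm_torusChar_sub_one_lt {B : Set (ι → ℤ)} {v : ι → ℤ}
    (hv : v ∈ Submodule.span ℤ B) {η : ℝ} (hη : 0 < η) (n : ℕ) :
    ∀ᶠ x in annihFilter B, ‖((torusChar v x ^ n : Circle) : ℂ) - 1‖ < η := by
  have h : Tendsto (fun x => torusChar v x ^ n) (annihFilter B) (𝓝 1) := by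
    simpa using (tendsto_torusChar_annihFilter hv).pow n
  filter_upwards [Metric.tendsto_nhds.1 h η hη] with x hx
  rwa [Circle.dist_one_right] at hx

lemma exists_radius_of_eventually_inf {p : (ι → Circle) → Prop} {v : ι → ℤ}
    {l : Filter (ι → Circle)} (h : ∀ᶠ x in comap (torusChar v) (𝓝 1) ⊓ l, p x) :
    ∃ δ > 0, ∀ᶠ x in l, ‖(torusChar v x : ℂ) - 1‖ < δ → p x := by
  obtain ⟨s, hs, t, ht, hst⟩ := mem_inf_iff_superset.1 h
  obtain ⟨u, hu, hus⟩ := mem_comap.1 hs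
  obtain ⟨δ, hδ, hball⟩ := Metric.mem_nhds_iff.1 hu
  refine ⟨δ, hδ, ?_⟩
  filter_upwards [ht] with x hx hlt
  refine hst ⟨hus (hball ?_), hx⟩
  rwa [Metric.mem_ball, Circle.dist_one_right]

/-! ### Torsion and rank of relation lattices -/

/-- The torsion of a finitely generated quotient is annihilated by a single nonzero integer. -/
lemma exists_torsion_exponent (N : Submodule ℤ (ι → ℤ)) :
    ∃ Δ : ℕ, 1 ≤ Δ ∧ ∀ v : ι → ℤ, ∀ n : ℤ, n ≠ 0 → n • v ∈ N → (Δ : ℤ) • v ∈ N := by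
  obtain ⟨a, ha, ha0⟩ := Submodule.annihilator_top_inter_nonZeroDivisors
    (Submodule.torsion_isTorsion (R := ℤ) (M := (ι → ℤ) ⧸ N))
  refine ⟨a.natAbs, Int.natAbs_pos.2 (nonZeroDivisors.ne_zero ha0), fun v n hn hv => ?_⟩
  have hmem : N.mkQ v ∈ Submodule.torsion ℤ ((ι → ℤ) ⧸ N) := by
    refine (Submodule.mem_torsion_iff _).2 ⟨⟨n, mem_nonZeroDivisors_of_ne_zero hn⟩, ?_⟩
    change n • N.mkQ v = 0
    rw [← map_smul]
    exact (Submodule.Quotient.mk_eq_zero N).2 hv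
  have h := Submodule.mem_annihilator.1 ha ⟨_, hmem⟩ trivial
  have h' : a • v ∈ N := by
    have := congrArg Subtype.val h
    change a • N.mkQ v = 0 at this
    rw [← map_smul] at this
    exact (Submodule.Quotient.mk_eq_zero N).1 this
  rcases Int.natAbs_eq a with h1 | h1
  · rwa [← h1]
  · rw [h1, neg_smul] at h'
    exact N.neg_mem_iff.1 h'

/-- A uniform exponent for the torsion of `ℤ^ι` modulo spans of subsets of a finite set. -/
lemma exists_uniform_torsion_exponent (F : Finset (ι → ℤ)) :
    ∃ Δ : ℕ, 1 ≤ Δ ∧ ∀ B ⊆ F, ∀ v : ι → ℤ, ∀ n : ℤ, n ≠ 0 →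
      n • v ∈ Submodule.span ℤ (B : Set (ι → ℤ)) →
      (Δ : ℤ) • v ∈ Submodule.span ℤ (B : Set (ι → ℤ)) := by
  choose Δ hΔ h using fun B : Finset (ι → ℤ) =>
    exists_torsion_exponent (Submodule.span ℤ (B : Set (ι → ℤ)))
  refine ⟨∏ B ∈ F.powerset, Δ B, Finset.one_le_prod' fun B _ => hΔ B,
    fun B hB v n hn hv => ?_⟩
  obtain ⟨c, hc⟩ := Finset.dvd_prod_of_mem Δ (Finset.mem_powerset.2 hB)
  rw [hc, mul_comm, Nat.cast_mul, mul_smul]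
  exact Submodule.smul_mem _ _ (h B v n hn hv)

lemma exists_smul_mem_of_finrank_le {M : Type*} [AddCommGroup M] [Module.Finite ℤ M]
    (N : Submodule ℤ M) (hN : Module.finrank ℤ M ≤ Module.finrank ℤ N) (v : M) :
    ∃ n : ℤ, n ≠ 0 ∧ n • v ∈ N := by
  have h0 : Module.finrank ℤ (M ⧸ N) = 0 := by
    have := Submodule.finrank_quotient_add_finrank N
    omega
  obtain ⟨a, ha, h⟩ := Module.finrank_eq_zero_iff.1 h0 (N.mkQ v)
  refine ⟨a, ha, ?_⟩
  rw [← map_smul] at h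
  exact (Submodule.Quotient.mk_eq_zero N).1 h

/-- With equal ranks the larger span would be torsion over the smaller, so a multiple of `v` would
lie in it. -/
lemma finrank_span_lt_of_notMem (B : Set (ι → ℤ)) (v : ι → ℤ) {c : ℤ} (hc : c ≠ 0)
    (hv : ∀ n : ℤ, n ≠ 0 → n • v ∉ Submodule.span ℤ B) :
    Module.finrank ℤ (Submodule.span ℤ B) <
      Module.finrank ℤ (Submodule.span ℤ (insert (c • v) B)) := by
  by_contra! hle
  have hsub : Submodule.span ℤ B ≤ Submodule.span ℤ (insert (c • v) B) :=
    Submodule.span_mono (Set.subset_insert _ _)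
  rw [← (Submodule.submoduleOfEquivOfLe hsub).finrank_eq] at hle
  obtain ⟨n, hn, h⟩ := exists_smul_mem_of_finrank_le _ hle
    ⟨c • v, Submodule.subset_span (Set.mem_insert _ _)⟩
  refine hv (n * c) (mul_ne_zero hn hc) ?_
  rw [mul_smul]
  exact h

/-! ### Trigonometric polynomials along progressions -/

lemma norm_one_add_sum_le {z : ι → Circle} {ε : ℝ} {i : ι} (hi : ε ≤ ‖(z i : ℂ) - 1‖)
    (hε : 0 < ε) :
    ‖1 + ∑ a, (z a : ℂ)‖ ≤ Fintype.card ι - 1 + Real.sqrt (4 - ε ^ 2) := by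
  classical
  have h1 : ‖1 + (z i : ℂ)‖ ≤ Real.sqrt (4 - ε ^ 2) := by
    apply Real.le_sqrt_of_sq_le
    have h := parallelogram_law_with_norm ℝ (z i : ℂ) 1
    simp only [Circle.norm_coe, norm_one] at h
    rw [add_comm 1]
    nlinarith
  have h2 : ‖∑ a ∈ Finset.univ.erase i, (z a : ℂ)‖ ≤ Fintype.card ι - 1 := by
    refine (norm_sum_le _ _).trans ?_
    have : 1 ≤ Fintype.card ι := Fintype.card_pos_iff.2 ⟨i⟩
    simp only [Circle.norm_coe, Finset.sum_const, nsmul_eq_mul, mul_one]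
    rw [Finset.card_erase_of_mem (Finset.mem_univ i), Finset.card_univ, Nat.cast_sub this,
      Nat.cast_one]
  rw [← Finset.add_sum_erase _ _ (Finset.mem_univ i), ← add_assoc]
  linarith [norm_add_le (1 + (z i : ℂ)) (∑ a ∈ Finset.univ.erase i, (z a : ℂ))]

lemma norm_mul_geom_sum_Icc_le (u z : Circle) {δ : ℝ} (hδ : 0 < δ) (hz : δ ≤ ‖(z : ℂ) - 1‖)
    (N : ℕ) :
    ‖∑ j ∈ Finset.Icc 1 N, ((u * z ^ j : Circle) : ℂ)‖ ≤ 2 / δ := by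
  have hne : (z : ℂ) - 1 ≠ 0 := norm_pos_iff.1 (hδ.trans_le hz)
  have hsum : ∑ j ∈ Finset.Icc 1 N, ((u * z ^ j : Circle) : ℂ) =
      u * (z * (((z : ℂ) ^ N - 1) / (z - 1))) := by
    rw [← geom_sum_eq (sub_ne_zero.1 hne), Finset.mul_sum, Finset.mul_sum, Finset.range_eq_Ico]
    refine (Finset.sum_nbij' (· + 1) (· - 1) ?_ ?_ ?_ ?_ ?_).symm
    all_goals intro j hj; simp only [Finset.mem_Ico, Finset.mem_Icc] at *
    · omega
    · omega
    · omega
    · omega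
    · simp only [Circle.coe_mul, Circle.coe_pow, pow_succ']
  rw [hsum]
  simp only [norm_mul, norm_div, Circle.norm_coe, one_mul]
  have : ‖(z : ℂ) ^ N - 1‖ ≤ 2 := by
    refine (norm_sub_le _ _).trans ?_
    rw [norm_pow, Circle.norm_coe, norm_one, one_pow]
    norm_num
  gcongr

/-- A lower bound for the mean square of a trigonometric polynomial along a progression. -/
lemma le_sum_norm_sq_of_dichotomy {κ : Type*} (K : Finset κ) (a : κ → ℝ) (ha : ∀ k ∈ K, 0 ≤ a k)
    (f : κ → ι → ℤ) {δ η : ℝ} (hδ : 0 < δ) (hη : 0 < η) {N : ℕ} (hN : 2 / δ ≤ η * N)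
    (γ ω : ι → Circle)
    (h : ∀ k ∈ K, ∀ l ∈ K, δ ≤ ‖(torusChar (f k - f l) ω : ℂ) - 1‖ ∨
      ∀ j ∈ Finset.Icc 1 N, ‖(torusChar (f k - f l) (γ * ω ^ j) : ℂ) - 1‖ ≤ 1) :
    N * (∑ k ∈ K, a k ^ 2 - η * (∑ k ∈ K, a k) ^ 2) ≤
      ∑ j ∈ Finset.Icc 1 N, ‖∑ k ∈ K, (a k : ℂ) * torusChar (f k) (γ * ω ^ j)‖ ^ 2 := by
  classical
  have hsq (x : ι → Circle) : ‖∑ k ∈ K, (a k : ℂ) * torusChar (f k) x‖ ^ 2 =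
      ∑ k ∈ K, ∑ l ∈ K, a k * a l * (torusChar (f k - f l) x : ℂ).re := by
    have h1 : ((‖∑ k ∈ K, (a k : ℂ) * torusChar (f k) x‖ ^ 2 : ℝ) : ℂ) =
        ∑ k ∈ K, ∑ l ∈ K, ((a k * a l : ℝ) : ℂ) * (torusChar (f k - f l) x : ℂ) := by
      push_cast
      rw [← Complex.mul_conj', map_sum, Finset.sum_mul_sum]
      refine Finset.sum_congr rfl fun k _ => Finset.sum_congr rfl fun l _ => ?_
      rw [torusChar_sub, map_mul, Complex.conj_ofReal, Circle.coe_mul, Circle.coe_inv_eq_conj]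
      exact mul_mul_mul_comm _ _ _ _
    have h2 := congrArg Complex.re h1
    simpa only [Complex.ofReal_re, Complex.re_sum, Complex.re_ofReal_mul] using h2
  have hterm (k) (hk : k ∈ K) (l) (hl : l ∈ K) :
      (if k = l then (N : ℝ) * a k ^ 2 else 0) - N * η * (a k * a l) ≤
        ∑ j ∈ Finset.Icc 1 N, a k * a l * (torusChar (f k - f l) (γ * ω ^ j) : ℂ).re := by
    have hkl := mul_nonneg (ha k hk) (ha l hl)
    rw [← Finset.mul_sum]
    split_ifs with heq
    · subst heq
      simp only [sub_self, torusChar_zero, Circle.coe_one, Complex.one_re, Finset.sum_const,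
        Nat.card_Icc, add_tsub_cancel_right, nsmul_eq_mul, mul_one]
      have : 0 ≤ N * η * (a k * a k) := by positivity
      nlinarith
    · have key : -(N * η) ≤
          ∑ j ∈ Finset.Icc 1 N, (torusChar (f k - f l) (γ * ω ^ j) : ℂ).re := by
        -- Far from `1` the geometric sum is bounded; within distance `1` of `1` real parts are
        -- nonnegative.
        rcases h k hk l hl with hfar | hnear
        · have h1 := norm_mul_geom_sum_Icc_le (torusChar (f k - f l) γ) _ hδ hfar N
          simp only [← map_pow, ← map_mul] at h1
          have h2 := (Complex.abs_re_le_norm _).trans h1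
          rw [Complex.re_sum] at h2
          linarith [(abs_le.1 h2).1]
        · have h1 : 0 ≤ ∑ j ∈ Finset.Icc 1 N, (torusChar (f k - f l) (γ * ω ^ j) : ℂ).re := by
            refine Finset.sum_nonneg fun j hj => ?_
            have := (Complex.abs_re_le_norm _).trans (hnear j hj)
            rw [Complex.sub_re, Complex.one_re] at this
            linarith [(abs_le.1 this).1]
          have : 0 ≤ N * η := by positivity
          linarith
      nlinarith
  calc N * (∑ k ∈ K, a k ^ 2 - η * (∑ k ∈ K, a k) ^ 2)
      = ∑ k ∈ K, ∑ l ∈ K, ((if k = l then (N : ℝ) * a k ^ 2 else 0) - N * η * (a k * a l)) := by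
        simp only [Finset.sum_sub_distrib, Finset.sum_ite_eq, ← Finset.mul_sum]
        rw [Finset.sum_congr rfl fun k hk => if_pos hk, ← Finset.mul_sum, ← Finset.sum_mul]
        ring
    _ ≤ ∑ k ∈ K, ∑ l ∈ K,
          ∑ j ∈ Finset.Icc 1 N, a k * a l * (torusChar (f k - f l) (γ * ω ^ j) : ℂ).re :=
        Finset.sum_le_sum fun k hk => Finset.sum_le_sum fun l hl => hterm k hk l hl
    _ = _ := by
        simp only [hsq]
        rw [Finset.sum_comm (s := Finset.Icc 1 N)]
        exact Finset.sum_congr rfl fun k _ => Finset.sum_comm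

/-- Finitely many characters decide whether a finite progression in the torus approaches `1`. -/
lemma exists_testing_frequencies (ι : Type*) [Fintype ι] {ε : ℝ} (hε : 0 < ε) :
    ∃ T : Finset (ι → ℤ), ∀ δ > 0, ∃ N : ℕ, 1 ≤ N ∧ ∀ γ ω : ι → Circle,
      (∀ χ ∈ T, δ ≤ ‖(torusChar χ ω : ℂ) - 1‖ ∨
        ∀ j ∈ Finset.Icc 1 N, ‖(torusChar χ (γ * ω ^ j) : ℂ) - 1‖ ≤ 1) →
      ∃ j ∈ Finset.Icc 1 N, ∀ i, ‖(((γ * ω ^ j) i : Circle) : ℂ) - 1‖ < ε := by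
  classical
  cases isEmpty_or_nonempty ι with
  | inl _ => exact ⟨∅, fun δ _ => ⟨1, le_rfl, fun _ _ _ => ⟨1, by simp, isEmptyElim⟩⟩⟩
  | inr _ => ?_
  set d : ℝ := (Fintype.card ι : ℝ) with hd
  set ρ : ℝ := (d - 1 + Real.sqrt (4 - ε ^ 2)) / (d + 1) with hρ
  have hd0 : 1 ≤ d := Nat.one_le_cast.2 Fintype.card_pos
  have hs2 : Real.sqrt (4 - ε ^ 2) < 2 := by
    rw [Real.sqrt_lt' two_pos]
    nlinarith [sq_pos_of_pos hε]
  have hρ1 : ρ ^ 2 < 1 := by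
    rw [sq_lt_one_iff_abs_lt_one, abs_lt]
    constructor
    · rw [hρ, lt_div_iff₀ (by linarith)]
      linarith [Real.sqrt_nonneg (4 - ε ^ 2)]
    · rw [hρ, div_lt_one (by linarith)]
      linarith
  set q := Fintype.card (Option ι) with hq
  have hlim := tendsto_pow_const_mul_const_pow_of_lt_one q (sq_nonneg ρ) hρ1
  -- The decay `ρ ^ (2 * n)` must beat the number of monomials, at most `(2 * n) ^ q`.
  obtain ⟨n, hn, hn1⟩ := ((hlim.eventually_lt_const
    (show (0 : ℝ) < 1 / (2 * 2 ^ q) by positivity)).and (eventually_ge_atTop 1)).exists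
  set K := (Finset.univ : Finset (Option ι)).piAntidiag n with hK
  have hKcard : (K.card : ℝ) ≤ 2 ^ q * n ^ q := by
    have hsub : K ⊆ Fintype.piFinset fun _ => Finset.range (n + 1) := by
      intro k hk
      rw [Fintype.mem_piFinset]
      intro o
      rw [Finset.mem_range, Nat.lt_succ_iff, ← (Finset.mem_piAntidiag.1 hk).1]
      exact Finset.single_le_sum (fun _ _ => Nat.zero_le _) (Finset.mem_univ o)
    have := Finset.card_le_card hsub
    rw [Fintype.card_piFinset, Finset.prod_const, Finset.card_range, Finset.card_univ] at this
    calc (K.card : ℝ) ≤ ((n + 1) ^ q : ℕ) := by exact_mod_cast this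
      _ ≤ ((2 * n) ^ q : ℕ) := by
        exact_mod_cast Nat.pow_le_pow_left (by omega) q
      _ = _ := by push_cast; ring
  set a : (Option ι → ℕ) → ℝ := fun k => Nat.multinomial Finset.univ k with hadef
  have ha (k) : 0 ≤ a k := Nat.cast_nonneg _
  set f : (Option ι → ℕ) → ι → ℤ := fun k i => k (some i) with hf
  have hsum : ∑ k ∈ K, a k = (d + 1) ^ n := by
    have := Finset.sum_pow_eq_sum_piAntidiag (Finset.univ : Finset (Option ι)) (fun _ => (1 : ℝ)) n
    simp at this
    rw [this]
  have hexp (x : ι → Circle) :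
      ∑ k ∈ K, (a k : ℂ) * torusChar (f k) x = (1 + ∑ i, (x i : ℂ)) ^ n := by
    have := Finset.sum_pow_eq_sum_piAntidiag (Finset.univ : Finset (Option ι))
      (fun o => o.elim (1 : ℂ) fun i => (x i : ℂ)) n
    rw [Fintype.sum_option] at this
    simp only [Option.elim] at this
    rw [this]
    refine Finset.sum_congr rfl fun k _ => ?_
    rw [Fintype.prod_option, torusChar_apply]
    have hcoe (y : ι → Circle) : ((∏ i, y i : Circle) : ℂ) = ∏ i, (y i : ℂ) :=
      map_prod Circle.coeHom _ _
    simp [hadef, hf, hcoe]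
  have hKpos : 0 < (K.card : ℝ) := by
    rw [Nat.cast_pos, Finset.card_pos]
    by_contra! hemp
    rw [hemp, Finset.sum_empty] at hsum
    have : 0 < (d + 1) ^ n := by positivity
    linarith
  have hcs := sq_sum_le_card_mul_sum_sq (s := K) (f := a)
  refine ⟨(K ×ˢ K).image fun p => f p.1 - f p.2, fun δ hδ => ?_⟩
  obtain ⟨N, hN⟩ := exists_nat_ge (2 / δ / (1 / (2 * K.card)))
  -- This `η` costs half of the Cauchy–Schwarz lower bound.
  have hη : (0 : ℝ) < 1 / (2 * K.card) := by positivity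
  have hN' := (div_le_iff₀' hη).1 hN
  have hNpos : (0 : ℝ) < N := lt_of_lt_of_le (by positivity) hN
  refine ⟨N, by exact_mod_cast hNpos, fun γ ω h => ?_⟩
  by_contra! hcon
  have hlow := le_sum_norm_sq_of_dichotomy K a (fun k _ => ha k) f hδ hη hN' γ ω
    (fun k hk l hl => h _ (Finset.mem_image.2 ⟨(k, l), Finset.mem_product.2 ⟨hk, hl⟩, rfl⟩))
  have hup : ∑ j ∈ Finset.Icc 1 N, ‖∑ k ∈ K, (a k : ℂ) * torusChar (f k) (γ * ω ^ j)‖ ^ 2 ≤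
      N * ((d + 1) ^ n * ρ ^ n) ^ 2 := by
    refine (Finset.sum_le_card_nsmul _ _ (((d + 1) ^ n * ρ ^ n) ^ 2) fun j hj => ?_).trans ?_
    · obtain ⟨i, hi⟩ := hcon j hj
      rw [hexp, norm_pow, ← mul_pow, hρ, mul_div_cancel₀ _ (by positivity)]
      gcongr
      exact norm_one_add_sum_le hi hε
    · simp
  have h3 := le_of_mul_le_mul_left (hlow.trans hup) hNpos
  rw [hsum] at h3 hcs
  set R := (d + 1) ^ n with hR
  have hRpos : 0 < R := by positivity
  have h4 : (ρ ^ n) ^ 2 * K.card < 1 / 2 := by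
    calc (ρ ^ n) ^ 2 * K.card ≤ (ρ ^ n) ^ 2 * (2 ^ q * n ^ q) := by gcongr
      _ = 2 ^ q * (n ^ q * (ρ ^ 2) ^ n) := by ring
      _ < 2 ^ q * (1 / (2 * 2 ^ q)) := by gcongr
      _ = 1 / 2 := by field_simp
  have h5 := mul_le_mul_of_nonneg_left h3 hKpos.le
  have h6 : (K.card : ℝ) * (1 / (2 * K.card) * R ^ 2) = R ^ 2 / 2 := by field_simp
  have h7 := mul_lt_mul_of_pos_left h4 (sq_pos_of_pos hRpos)
  rw [mul_sub, h6, mul_pow] at h5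
  linarith

end Torus

/-! ### Induction on the number of missing relations -/

/-- A return time of the form `D i * (L * j + 1)` with `m ≤ i < r` and `1 ≤ j ≤ Θ`, or `D r`. -/
def HasReturn {ι : Type*} (L : ℕ) (ε : ℝ) (D : ℕ → ℕ) (m r Θ : ℕ) (x : ι → Circle) : Prop :=
  (∃ i, m ≤ i ∧ i < r ∧ ∃ j, 1 ≤ j ∧ j ≤ Θ ∧
    ∀ a, ‖((x a ^ (D i * (L * j + 1)) : Circle) : ℂ) - 1‖ < ε) ∨
  ∀ a, ‖((x a ^ D r : Circle) : ℂ) - 1‖ < ε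

lemma HasReturn.mono {ι : Type*} {L : ℕ} {ε : ℝ} {D D' : ℕ → ℕ} {m m' r Θ Θ' : ℕ}
    {x : ι → Circle} (h : HasReturn L ε D m r Θ x) (hm : m' ≤ m) (hΘ : Θ ≤ Θ') (hmr : m ≤ r)
    (hD : ∀ i, m ≤ i → D i = D' i) : HasReturn L ε D' m' r Θ' x := by
  rcases h with ⟨i, hi, hir, j, hj, hjΘ, hx⟩ | hx
  · exact .inl ⟨i, hm.trans hi, hir, j, hj, hjΘ.trans hΘ, hD i hi ▸ hx⟩
  · exact .inr (hD r hmr ▸ hx)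

section Induction

variable {ι : Type*} [Fintype ι]

lemma exists_radius_forall_finset {α : Type*} (T : Finset α) (P : α → ℝ → ℕ → Prop)
    (hP : ∀ χ δ δ' Θ Θ', δ' ≤ δ → Θ ≤ Θ' → P χ δ Θ → P χ δ' Θ')
    (h : ∀ χ ∈ T, ∃ δ > 0, ∃ Θ, P χ δ Θ) : ∃ δ > 0, ∃ Θ, ∀ χ ∈ T, P χ δ Θ := by
  classical
  induction T using Finset.induction_on with
  | empty => exact ⟨1, one_pos, 0, by simp⟩
  | insert χ T _ ih =>
    obtain ⟨δ, hδ, Θ, h1⟩ := ih fun χ hχ => h χ (Finset.mem_insert_of_mem hχ)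
    obtain ⟨δ', hδ', Θ', h2⟩ := h χ (Finset.mem_insert_self _ _)
    refine ⟨min δ δ', lt_min hδ hδ', max Θ Θ', fun ψ hψ => ?_⟩
    rcases Finset.mem_insert.1 hψ with rfl | hψ
    · exact hP _ _ _ _ _ (min_le_right _ _) (le_max_right _ _) h2
    · exact hP _ _ _ _ _ (min_le_left _ _) (le_max_left _ _) (h1 ψ hψ)

/-- Return times for points of the torus that almost satisfy `m` independent relations
taken from a given finite set. -/
lemma exists_multipliers {L : ℕ} (hL : 1 ≤ L) {ε : ℝ} (hε : 0 < ε) (c : ℕ) :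
    ∀ m : ℕ, m + c = Fintype.card ι → ∀ F : Finset (ι → ℤ),
      ∃ D : ℕ → ℕ, (∀ i, 1 ≤ D i) ∧ ∀ B ⊆ F,
        m ≤ Module.finrank ℤ (Submodule.span ℤ (B : Set (ι → ℤ))) →
        ∃ Θ, ∀ᶠ x in annihFilter (B : Set (ι → ℤ)), HasReturn L ε D m (Fintype.card ι) Θ x := by
  classical
  induction c with
  | zero =>
    intro m hm F
    obtain ⟨Δ, hΔ, hF⟩ := exists_uniform_torsion_exponent F
    refine ⟨fun _ => Δ, fun _ => hΔ, fun B hB hrank => ⟨0, ?_⟩⟩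
    have hnear : ∀ a : ι, ∀ᶠ x in annihFilter (B : Set (ι → ℤ)),
        ‖((x a ^ Δ : Circle) : ℂ) - 1‖ < ε := fun a => by
      obtain ⟨n, hn, hv⟩ := exists_smul_mem_of_finrank_le _
        ((Module.finrank_pi ℤ).le.trans (hm.ge.trans hrank)) (Pi.single a 1 : ι → ℤ)
      filter_upwards [eventually_norm_torusChar_sub_one_lt (hF B hB _ n hn hv) hε 1] with x hx
      rwa [torusChar_zsmul, torusChar_single, pow_one, zpow_natCast] at hx
    filter_upwards [eventually_all.2 hnear] with x hx
    exact .inr hx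
  | succ c ih =>
    intro m hm F
    obtain ⟨Δ, hΔ, hF⟩ := exists_uniform_torsion_exponent F
    obtain ⟨T, hT⟩ := exists_testing_frequencies ι hε
    have hLΔ : ((L * Δ : ℕ) : ℤ) ≠ 0 := by positivity
    -- Enlarging `F` by every possible new relation keeps `D` independent of `B`.
    obtain ⟨D, hD, hDF⟩ := ih (m + 1) (by omega) (F ∪ T.image fun χ => ((L * Δ : ℕ) : ℤ) • χ)
    refine ⟨Function.update D m Δ, fun i => ?_, fun B hB hrank => ?_⟩
    · rcases eq_or_ne i m with rfl | hi
      · simpa using hΔ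
      · simpa [hi] using hD i
    have hpow (χ : ι → ℤ) (x : ι → Circle) :
        torusChar (((L * Δ : ℕ) : ℤ) • χ) x = torusChar χ (x ^ (L * Δ)) := by
      rw [torusChar_zsmul, map_pow, zpow_natCast]
    -- `N` is quantified after `δ` because the testing length depends on `δ`; the neighbourhood then
    -- shrinks with `N`.
    have hχ : ∀ χ ∈ T, ∃ δ > 0, ∃ Θ : ℕ, ∀ N : ℕ, ∀ᶠ x in annihFilter (B : Set (ι → ℤ)),
        HasReturn L ε (Function.update D m Δ) m (Fintype.card ι) Θ x ∨
        δ ≤ ‖(torusChar χ (x ^ (L * Δ)) : ℂ) - 1‖ ∨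
        ∀ j ∈ Finset.Icc 1 N, ‖(torusChar χ (x ^ Δ * (x ^ (L * Δ)) ^ j) : ℂ) - 1‖ ≤ 1 := by
      intro χ hχT
      by_cases htor : ∃ n : ℤ, n ≠ 0 ∧ n • χ ∈ Submodule.span ℤ (B : Set (ι → ℤ))
      · obtain ⟨n, hn, hmem⟩ := htor
        refine ⟨1, one_pos, 0, fun N => ?_⟩
        have hev : ∀ᶠ x in annihFilter (B : Set (ι → ℤ)), ∀ j ∈ Finset.Icc 1 N,
            ‖((torusChar ((Δ : ℤ) • χ) x ^ (L * j + 1) : Circle) : ℂ) - 1‖ < 1 :=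
          (Filter.eventually_all_finset _).2 fun j _ =>
            eventually_norm_torusChar_sub_one_lt (hF B hB χ n hn hmem) one_pos _
        filter_upwards [hev] with x hx
        refine .inr (.inr fun j hj => ?_)
        have heq : torusChar χ (x ^ Δ * (x ^ (L * Δ)) ^ j) =
            torusChar ((Δ : ℤ) • χ) x ^ (L * j + 1) := by
          rw [torusChar_zsmul, zpow_natCast, ← map_pow, ← map_pow]
          rw [← pow_mul, ← pow_mul, ← pow_add]
          rw [show Δ + L * Δ * j = Δ * (L * j + 1) by ring]
        rw [heq]
        exact (hx j hj).le
      · push Not at htor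
        have hB' : insert (((L * Δ : ℕ) : ℤ) • χ) B ⊆
            F ∪ T.image fun χ => ((L * Δ : ℕ) : ℤ) • χ :=
          Finset.insert_subset (Finset.mem_union_right _ (Finset.mem_image_of_mem _ hχT))
            (hB.trans Finset.subset_union_left)
        have hlt := finrank_span_lt_of_notMem (B : Set (ι → ℤ)) χ hLΔ htor
        rw [← Finset.coe_insert] at hlt
        obtain ⟨Θ, hΘ⟩ := hDF _ hB' (by omega)
        rw [Finset.coe_insert, annihFilter_insert] at hΘ
        obtain ⟨δ, hδ, hev⟩ := exists_radius_of_eventually_inf hΘ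
        refine ⟨δ, hδ, Θ, fun _ => ?_⟩
        filter_upwards [hev] with x hx
        rw [hpow] at hx
        rcases lt_or_ge ‖(torusChar χ (x ^ (L * Δ)) : ℂ) - 1‖ δ with h | h
        · refine .inl ((hx h).mono (by omega) le_rfl (by omega) fun i hi => ?_)
          rw [Function.update_of_ne (by omega)]
        · exact .inr (.inl h)
    obtain ⟨δ, hδ, Θ, hδΘ⟩ := exists_radius_forall_finset T _ (fun χ δ δ' Θ Θ' h1 h2 h N => by
      filter_upwards [h N] with x hx
      exact hx.imp (fun h => h.mono le_rfl h2 (by omega) fun _ _ => rfl)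
        (Or.imp_left h1.trans)) hχ
    obtain ⟨N, _, hN⟩ := hT δ hδ
    refine ⟨max Θ N, ?_⟩
    filter_upwards [(Filter.eventually_all_finset T).2 fun χ hχT => hδΘ χ hχT N] with x hx
    by_cases hret : HasReturn L ε (Function.update D m Δ) m (Fintype.card ι) Θ x
    · exact hret.mono le_rfl (le_max_left _ _) (by omega) fun _ _ => rfl
    obtain ⟨j, hj, hxj⟩ := hN (x ^ Δ) (x ^ (L * Δ)) fun χ hχT => (hx χ hχT).resolve_left hret
    rw [Finset.mem_Icc] at hj
    refine .inl ⟨m, le_rfl, by omega, j, hj.1, hj.2.trans (le_max_right _ _), fun a => ?_⟩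
    have heq : x ^ Δ * (x ^ (L * Δ)) ^ j = x ^ (Δ * (L * j + 1)) := by
      rw [← pow_mul, ← pow_add, show Δ + L * Δ * j = Δ * (L * j + 1) by ring]
    rw [Function.update_self, ← Pi.pow_apply, ← heq]
    exact hxj a

end Induction

/-! ### Assembly -/

theorem lemma4p1 (r : ℕ) (hr : 3 ≤ r) (ε : ℝ) (hε : 0 < ε) (L : ℕ) (hL : 1 ≤ L) :
    ∃ (Δ : Finset ℕ → ℕ) (Θ Q : ℕ),
      (∀ A ⊆ Finset.Icc 1 (r - 1), 1 ≤ Δ A) ∧ 1 ≤ Θ ∧ 1 ≤ Q ∧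
      ∀ (H : ℕ), 1 ≤ H → ∀ lam : Fin r → Circle,
        ∃ n : ℕ,
          ((∃ A ⊆ Finset.Icc 1 (r - 1), A ≠ ∅ ∧
              n ∈ {m : ℕ | ∃ j : ℕ, 1 ≤ j ∧ j ≤ Θ ∧ m = H * Δ A * (L * j + 1)}) ∨
            n ∈ ({H * Δ ∅} : Set ℕ) ∨
            n ∈ {m : ℕ | ∃ q : ℕ, 1 ≤ q ∧ q ≤ Q ∧ m = H * q + 1}) ∧
          ∀ i : Fin r, ‖((lam i ^ n : Circle) : ℂ) - 1‖ < ε := by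
  classical
  obtain ⟨T, hT⟩ := exists_testing_frequencies (Fin r) hε
  obtain ⟨D, hD, hDT⟩ := exists_multipliers (ι := Fin r) hL hε (r - 1) 1
    (by rw [Fintype.card_fin]; omega) T
  rw [Fintype.card_fin] at hDT
  have hχ : ∀ χ ∈ T, ∃ δ > 0, ∃ Θ : ℕ, ∀ x : Fin r → Circle,
      HasReturn L ε D 1 r Θ x ∨ δ ≤ ‖(torusChar χ x : ℂ) - 1‖ ∨ χ = 0 := by
    intro χ hχT
    rcases eq_or_ne χ 0 with h0 | h0
    · exact ⟨1, one_pos, 0, fun _ => .inr (.inr h0)⟩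
    have hlt := finrank_span_lt_of_notMem (∅ : Set (Fin r → ℤ)) χ one_ne_zero fun n hn h => by
      rw [Submodule.span_empty, Submodule.mem_bot, smul_eq_zero] at h
      exact h.elim hn h0
    rw [one_smul, ← Finset.coe_empty, ← Finset.coe_insert] at hlt
    obtain ⟨Θ, hΘ⟩ := hDT {χ} (Finset.singleton_subset_iff.2 hχT) (Nat.one_le_of_lt hlt)
    rw [Finset.coe_singleton, ← insert_empty_eq, annihFilter_insert] at hΘ
    obtain ⟨δ, hδ, hev⟩ := exists_radius_of_eventually_inf hΘ
    -- No relation remains in the filter, so "eventually" means for all `x`.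
    rw [annihFilter, iInf_emptyset, eventually_top] at hev
    exact ⟨δ, hδ, Θ, fun x => (lt_or_ge ‖(torusChar χ x : ℂ) - 1‖ δ).imp (hev x) .inl⟩
  obtain ⟨δ, hδ, Θ, hδΘ⟩ := exists_radius_forall_finset T _ (fun χ δ δ' Θ Θ' h1 h2 h x =>
    (h x).imp (fun h => h.mono le_rfl h2 (by omega) fun _ _ => rfl) (Or.imp_left h1.trans)) hχ
  obtain ⟨Q, hQ1, hQ⟩ := hT δ hδ
  -- Only the rank matters: singletons `{i}` carry `D i`, and other nonempty sets are never used.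
  refine ⟨fun A => if A = ∅ then D r else D (A.sup id), max Θ 1, Q, fun A _ => ?_,
    le_max_right _ _, hQ1, fun H _ lam => ?_⟩
  · dsimp only
    split_ifs <;> exact hD _
  by_cases hret : HasReturn L ε D 1 r Θ (lam ^ H)
  · rcases hret with ⟨i, hi, hir, j, hj, hjΘ, hx⟩ | hx
    · refine ⟨H * D i * (L * j + 1), .inl ⟨{i}, ?_, Finset.singleton_ne_empty i,
        j, hj, hjΘ.trans (le_max_left _ _), by simp⟩, fun a => ?_⟩
      · rw [Finset.singleton_subset_iff, Finset.mem_Icc]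
        omega
      · rw [mul_assoc, pow_mul]
        exact hx a
    · refine ⟨H * D r, .inr (.inl (by simp)), fun a => ?_⟩
      rw [pow_mul]
      exact hx a
  · obtain ⟨q, hq, hlam⟩ := hQ lam (lam ^ H) fun χ hχT => by
      rcases (hδΘ χ hχT (lam ^ H)).resolve_left hret with h | rfl
      · exact .inl h
      · exact .inr fun j _ => by simp [torusChar_zero]
    rw [Finset.mem_Icc] at hq
    refine ⟨H * q + 1, .inr (.inr ⟨q, hq.1, hq.2, rfl⟩), fun a => ?_⟩
    have heq : lam * (lam ^ H) ^ q = lam ^ (H * q + 1) := by rw [← pow_mul, pow_succ']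
    rw [← Pi.pow_apply, ← heq]
    exact hlam a
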